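/- For a function $f$ let $\Delta f(x)=f(x+1)-f(x)$, so that $\Delta^n f(x)=\sum_{\nu=0}^n(-1)^{n-\nu}\binom n\nu f(x+\nu)$. Put $$a_n=\frac{(-1)^{n+1}}{2^n}\,\Delta^n\log x\,\Big|_{x=1}\quad(n\ge 1),\qquad L^*(f)=\sum_{n\ge1}a_n f(n)\quad(f\in\mathbb C[x]),$$ and, for $n\ge1$, $$p_n(x)=\sum_{\nu=0}^n(-1)^\nu 2^{n-\nu}\binom{x+\nu}{\nu}\,\Delta^\nu (x+1)^n\in\mathbb Q[x].$$ The series $L^*(f)$ converges absolutely for every $f\in\mathbb C[x]$, and the following hold. (1) For every even integer $n\ge2$ one has $p_n'(0)\ne0$ and $$\frac{\zeta(n+1)}{\zeta(n)}=\Big(1-\frac1n\Big)\Big(1-\frac1{2^{n+1}-1}\Big)\frac{L^*(p_n)}{p_n'(0)}.$$ (2) $\displaystyle\lim_{n\to\infty,\;2\mid n}\frac{L^*(p_n)}{p_n'(0)}=1.$ (3) Let $N\ge1$, let $\alpha_1,\dots,\alpha_N$ be nonzero rational numbers and let $n_1<\dots<n_N$ be positive even integers. Then there is a polynomial $q\in\mathbb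 Q[x]$ of degree $n_N$ with $$\sum_{j=1}^N\alpha_j\,\frac{\zeta(n_j+1)}{\zeta(n_j)}=L^*(q).$$ -/

import Mathlib

open Polynomial Filter Topology

noncomputable section

namespace QuotZeta

/-- The coefficients `a_n = ((-1)^(n+1) / 2^n) * (Δ^n log)(1)`, where `Δ` is the forward
difference operator with step `1`. -/
def a (n : ℕ) : ℝ :=
  (-1) ^ (n + 1) / 2 ^ n * (fwdDiff (1 : ℝ))^[n] Real.log 1

/-- The linear functional `L*(f) = ∑_{n ≥ 1} a_n f(n)` on complex polynomials
(the sum is indexed by `n + 1` with `n ≥ 0`). -/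
def LStar (f : ℂ[X]) : ℂ :=
  ∑' n : ℕ, (a (n + 1) : ℂ) * f.eval ((n + 1 : ℕ) : ℂ)

/-- The binomial coefficient `binom(x + ν, ν) = (x + ν)(x + ν - 1) ⋯ (x + 1) / ν!`
as a polynomial in `x`. -/
def binomPoly (ν : ℕ) : ℚ[X] :=
  C ((ν.factorial : ℚ)⁻¹) * (descPochhammer ℚ ν).comp (X + (ν : ℚ[X]))

/-- The polynomial `Δ^ν (x + 1)^n` in `x`: the `ν`-th forward difference of `y ↦ (y + 1)^n`
at the indeterminate `y = X`. -/
def diffPow (ν n : ℕ) : ℚ[X] :=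
  (fwdDiff (1 : ℚ[X]))^[ν] (fun y => (y + 1) ^ n) X

/-- The polynomials `p_n(x) = ∑_{ν=0}^n (-1)^ν 2^(n-ν) binom(x + ν, ν) Δ^ν (x + 1)^n`. -/
def p (n : ℕ) : ℚ[X] :=
  ∑ ν ∈ Finset.range (n + 1), (-1) ^ ν * 2 ^ (n - ν) * binomPoly ν * diffPow ν n

/-- `L*(f)` for a rational polynomial `f`, viewed as a complex polynomial. -/
def LStarRat (f : ℚ[X]) : ℂ := LStar (f.map (algebraMap ℚ ℂ))

/-- The derivative `p_n'(0)`, a rational number. -/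
def dpZero (n : ℕ) : ℚ := (derivative (p n)).eval 0

end QuotZeta

end

/-
Put `D_m(s) = (-1)^m Δ^m x^(-s)` at `x = 1`, and for a polynomial `f` let
`B_f(s) = ∑ 2^(-m) f(m) D_m(s)`. A bound for `D_m` that is polynomial in `m`, locally uniformly in
`s`, makes `B_f` entire, with `B_f(0) = f(0)` and `B_f'(0) = L*(f)`. Since
`p_(n+1)(x) = (x + 1) (2 p_n(x) - p_n(x + 1))`, summation by parts gives
`B_(p_n)(s) = 2^n B_1(s - n)`, and `B_1(s) = 2 (1 - 2^(1-s)) ζ(s)` by Euler's series transformation.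
At `s = 0` this evaluates `p_n(0)` through `ζ(-n)` and `L*(p_n)` through `ζ'(-n)`.

To relate `p_n'(0)` to `ζ(1 - n)`, use the generating function
`∑ p_n(x) w^n / n! = (1 + tanh w)^(x+1)`. Its `x`-derivative at `x = 0` is
`(1 + tanh w) log (1 + tanh w)` with `log (1 + tanh w) = w - log cosh w`, whose even part
`w tanh w - log cosh w` yields `p_n'(0) = (n - 1) p_(n-1)(0)` for even `n`. The functional equation
then gives `4 ζ'(-n) ζ(n) = n ζ(n+1) ζ(1-n)`.
-/

namespace QuotZeta

section ForwardDifference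

variable {M R : Type*} [AddCommMonoid M] [CommRing R]

theorem fwdDiff_iter_affine_mul {h : M} {c : R} {w : M → R} (hw : ∀ x, w (x + h) = w x + c)
    (f : M → R) (n : ℕ) (x : M) :
    (fwdDiff h)^[n] (fun y => w y * f y) x =
      w x * (fwdDiff h)^[n] f x + n * c * (fwdDiff h)^[n - 1] f (x + h) := by
  induction n generalizing x with
  | zero => simp
  | succ n ih =>
    rw [Function.iterate_succ_apply', fwdDiff, ih, ih, Function.iterate_succ_apply', fwdDiff, hw]
    cases n with
    | zero => simp; ring
    | succ n =>
      simp only [Nat.add_sub_cancel, Function.iterate_succ_apply' _ n, fwdDiff]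
      push_cast
      ring

theorem neg_one_pow_mul_fwdDiff_iter_eq_sum (h : M) (f : M → R) (n : ℕ) (x : M) :
    (-1) ^ n * (fwdDiff h)^[n] f x =
      ∑ k ∈ Finset.range (n + 1), (-1) ^ k * (n.choose k : R) * f (x + k • h) := by
  rw [fwdDiff_iter_eq_sum_shift, Finset.mul_sum]
  refine Finset.sum_congr rfl fun k hk => ?_
  obtain ⟨j, rfl⟩ := Nat.exists_eq_add_of_le (Finset.mem_range_succ_iff.mp hk)
  have hsign : (-1 : R) ^ (k + j) * (-1) ^ j = (-1) ^ k := by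
    rw [pow_add, mul_assoc, ← mul_pow, neg_mul_neg, one_mul, one_pow, mul_one]
  rw [Nat.add_sub_cancel_left, zsmul_eq_mul]
  push_cast
  rw [← hsign]
  ring

end ForwardDifference

section Polynomials

/-- The operator `f(x) ↦ (x + 1) (2 f(x) - f(x + 1))`, whose iterates on `1` are the polynomials
`p n`. -/
noncomputable def raise {R : Type*} [CommRing R] (f : R[X]) : R[X] :=
  (X + 1) * (2 * f - taylor 1 f)

theorem map_raise {R S : Type*} [CommRing R] [CommRing S] (φ : R →+* S) (f : R[X]) :
    (raise f).map φ = raise (f.map φ) := by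
  simp [raise]

theorem monic_raise_and_natDegree_raise {R : Type*} [CommRing R] [Nontrivial R] {f : R[X]}
    (hf : f.Monic) : (raise f).Monic ∧ (raise f).natDegree = f.natDegree + 1 := by
  have hcoeff : (2 * f - taylor 1 f).coeff f.natDegree = 1 := by
    rw [coeff_sub, coeff_taylor_natDegree, two_mul, coeff_add, coeff_natDegree, hf.leadingCoeff]
    ring
  have hle : (2 * f - taylor 1 f).natDegree ≤ f.natDegree := by
    refine (natDegree_sub_le _ _).trans (max_le ?_ (natDegree_taylor f 1).le)
    rw [two_mul]
    exact natDegree_add_le_of_degree_le le_rfl le_rfl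
  have hmonic : (2 * f - taylor 1 f).Monic :=
    monic_of_natDegree_le_of_coeff_eq_one _ hle hcoeff
  have hdeg : (2 * f - taylor 1 f).natDegree = f.natDegree :=
    hle.antisymm (le_natDegree_of_ne_zero (by rw [hcoeff]; exact one_ne_zero))
  have hX : (X + 1 : R[X]).Monic := monic_X_add_C 1
  exact ⟨hX.mul hmonic, by
    rw [raise, hX.natDegree_mul hmonic, hdeg, ← C_1, natDegree_X_add_C, add_comm]⟩

theorem diffPow_eq_zero {ν n : ℕ} (h : n < ν) : diffPow ν n = 0 := by
  rw [diffPow, fwdDiff_iter_comp_add (1 : ℚ[X]) (fun y : ℚ[X] => y ^ n) 1,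
    fwdDiff_iter_pow_eq_zero_of_lt h]
  rfl

theorem taylor_diffPow (ν n : ℕ) :
    taylor 1 (diffPow ν n) = (fwdDiff (1 : ℚ[X]))^[ν] (fun y => (y + 1) ^ n) (X + 1) := by
  rw [diffPow, fwdDiff_iter_eq_sum_shift, fwdDiff_iter_eq_sum_shift, map_sum]
  refine Finset.sum_congr rfl fun k _ => ?_
  rw [taylor_apply]
  simp [zsmul_eq_mul]

theorem diffPow_succ (ν n : ℕ) :
    diffPow ν (n + 1) = (X + 1) * diffPow ν n + (ν : ℚ[X]) * taylor 1 (diffPow (ν - 1) n) := by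
  have hleibniz := fwdDiff_iter_affine_mul (h := (1 : ℚ[X])) (c := 1) (w := fun y => y + 1)
    (fun y => rfl) (fun y => (y + 1) ^ n) ν X
  rw [taylor_diffPow, diffPow, diffPow]
  simpa only [pow_succ', mul_one] using hleibniz

theorem succ_mul_binomPoly_succ (ν : ℕ) :
    ((ν + 1 : ℕ) : ℚ[X]) * binomPoly (ν + 1) = (X + 1) * taylor 1 (binomPoly ν) := by
  have hpoch : (descPochhammer ℚ (ν + 1)).comp (X + ((ν + 1 : ℕ) : ℚ[X])) =
      (X + 1) * taylor 1 ((descPochhammer ℚ ν).comp (X + (ν : ℚ[X]))) := by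
    rw [descPochhammer_succ_right, mul_comp, taylor_apply, comp_assoc, mul_comm]
    congr 1
    · simp
      ring
    · congr 1
      simp
      ring
  have hfact : ((ν + 1 : ℕ) : ℚ[X]) * C (((ν + 1).factorial : ℚ)⁻¹) =
      C ((ν.factorial : ℚ)⁻¹) := by
    rw [← C_eq_natCast, ← C_mul, Nat.factorial_succ, Nat.cast_mul, mul_inv,
      mul_inv_cancel_left₀ (Nat.cast_ne_zero.mpr ν.succ_ne_zero)]
  rw [binomPoly, ← mul_assoc, hfact, hpoch, binomPoly, taylor_mul, taylor_C]
  ring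

theorem p_zero : p 0 = 1 := by
  simp [p, binomPoly, diffPow]

theorem p_succ (n : ℕ) : p (n + 1) = raise (p n) := by
  have hdiag : ∑ ν ∈ Finset.range (n + 2),
      (-1) ^ ν * 2 ^ (n + 1 - ν) * binomPoly ν * diffPow ν n = 2 * p n := by
    rw [Finset.sum_range_succ, diffPow_eq_zero n.lt_succ_self, mul_zero, add_zero, p,
      Finset.mul_sum]
    refine Finset.sum_congr rfl fun ν hν => ?_
    rw [Nat.succ_sub (Finset.mem_range_succ_iff.mp hν), pow_succ]
    ring
  have hshift : ∑ ν ∈ Finset.range (n + 2),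
      (-1) ^ ν * 2 ^ (n + 1 - ν) * binomPoly ν * ((ν : ℚ[X]) * taylor 1 (diffPow (ν - 1) n)) =
      -((X + 1) * taylor 1 (p n)) := by
    rw [Finset.sum_range_succ', p, map_sum, Finset.mul_sum, ← Finset.sum_neg_distrib]
    simp only [Nat.cast_zero, zero_mul, mul_zero, add_zero]
    refine Finset.sum_congr rfl fun ν _ => ?_
    have htaylor : taylor 1 ((-1) ^ ν * 2 ^ (n - ν) : ℚ[X]) = (-1) ^ ν * 2 ^ (n - ν) := by
      simp [taylor_apply]
    rw [taylor_mul, taylor_mul, htaylor, Nat.add_sub_cancel, Nat.add_sub_add_right, pow_succ]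
    linear_combination
      (-(-1) ^ ν * 2 ^ (n - ν) * taylor 1 (diffPow ν n)) * succ_mul_binomPoly_succ ν
  rw [raise, mul_sub, ← hdiag, sub_eq_add_neg, ← hshift, Finset.mul_sum,
    ← Finset.sum_add_distrib, p]
  refine Finset.sum_congr rfl fun ν _ => ?_
  rw [diffPow_succ]
  ring

theorem monic_p_and_natDegree_p (n : ℕ) : (p n).Monic ∧ (p n).natDegree = n := by
  induction n with
  | zero => simp [p_zero]
  | succ n ih =>
    obtain ⟨hmonic, hdeg⟩ := monic_raise_and_natDegree_raise ih.1
    exact p_succ n ▸ ⟨hmonic, hdeg.trans (congrArg (· + 1) ih.2)⟩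

theorem eval_p_succ (n : ℕ) (x : ℚ) :
    (p (n + 1)).eval x = (x + 1) * (2 * (p n).eval x - (p n).eval (x + 1)) := by
  simp [p_succ, raise, taylor_eval]

theorem eval_derivative_p_succ (n : ℕ) (x : ℚ) :
    (derivative (p (n + 1))).eval x = 2 * (p n).eval x - (p n).eval (x + 1) +
      (x + 1) * (2 * (derivative (p n)).eval x - (derivative (p n)).eval (x + 1)) := by
  simp [p_succ, raise, taylor_apply, derivative_comp]

end Polynomials

section HyperbolicTangent

open scoped PowerSeries
open PowerSeries (evalNegHom exp constantCoeff)

theorem derivative_evalNegHom {R : Type*} [CommRing R] (f : R⟦X⟧) :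
    d⁄dX R (evalNegHom f) = -evalNegHom (d⁄dX R f) := by
  ext n
  simp only [evalNegHom, PowerSeries.coeff_derivative, PowerSeries.coeff_rescale, map_neg]
  ring

theorem coeff_eq_zero_of_evalNegHom_eq_neg {R : Type*} [CommRing R] [IsAddTorsionFree R]
    {f : R⟦X⟧} (hf : evalNegHom f = -f) {n : ℕ} (hn : Even n) : PowerSeries.coeff n f = 0 := by
  have h := congrArg (PowerSeries.coeff n) hf
  rw [evalNegHom, PowerSeries.coeff_rescale, hn.neg_one_pow, one_mul, map_neg] at h
  exact self_eq_neg.mp h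

/-- The formal power series of `tanh`. -/
noncomputable def tanhSeries : ℚ⟦X⟧ :=
  (exp ℚ - evalNegHom (exp ℚ)) * (exp ℚ + evalNegHom (exp ℚ))⁻¹

/-- The formal power series of `log cosh`, the antiderivative of `tanh` without constant term;
at `n = 0` the coefficient is the junk value `0 / 0 = 0`. -/
noncomputable def logCoshSeries : ℚ⟦X⟧ :=
  PowerSeries.mk fun n => PowerSeries.coeff (n - 1) tanhSeries / n

theorem constantCoeff_evalNegHom {R : Type*} [CommRing R] (f : R⟦X⟧) :
    constantCoeff (evalNegHom f) = constantCoeff f := by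
  simp [evalNegHom, ← PowerSeries.coeff_zero_eq_constantCoeff_apply,
    -PowerSeries.coeff_zero_eq_constantCoeff, PowerSeries.coeff_rescale]

theorem constantCoeff_exp_add_exp_neg :
    constantCoeff (exp ℚ + evalNegHom (exp ℚ)) = 2 := by
  rw [map_add, constantCoeff_evalNegHom, PowerSeries.constantCoeff_exp]
  norm_num

theorem exp_add_exp_neg_ne_zero : exp ℚ + evalNegHom (exp ℚ) ≠ 0 := fun h => by
  simpa [h] using constantCoeff_exp_add_exp_neg

theorem tanhSeries_mul :
    tanhSeries * (exp ℚ + evalNegHom (exp ℚ)) = exp ℚ - evalNegHom (exp ℚ) := by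
  rw [tanhSeries, mul_assoc, PowerSeries.inv_mul_cancel, mul_one]
  rw [constantCoeff_exp_add_exp_neg]
  exact two_ne_zero

theorem evalNegHom_evalNegHom {R : Type*} [CommRing R] (f : R⟦X⟧) :
    evalNegHom (evalNegHom f) = f := by
  rw [evalNegHom, PowerSeries.rescale_rescale]
  simp

theorem evalNegHom_tanhSeries : evalNegHom tanhSeries = -tanhSeries := by
  have h := congrArg evalNegHom tanhSeries_mul
  rw [map_mul, map_add, map_sub, evalNegHom_evalNegHom] at h
  refine mul_right_cancel₀ exp_add_exp_neg_ne_zero ?_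
  linear_combination h + tanhSeries_mul

theorem derivative_tanhSeries : d⁄dX ℚ tanhSeries = 1 - tanhSeries ^ 2 := by
  have h := congrArg (d⁄dX ℚ) tanhSeries_mul
  simp only [Derivation.leibniz, map_add, map_sub, derivative_evalNegHom,
    PowerSeries.derivative_exp, smul_eq_mul] at h
  refine mul_right_cancel₀ exp_add_exp_neg_ne_zero ?_
  linear_combination h + tanhSeries * tanhSeries_mul

theorem constantCoeff_tanhSeries : constantCoeff tanhSeries = 0 := by
  simpa using coeff_eq_zero_of_evalNegHom_eq_neg evalNegHom_tanhSeries Even.zero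

theorem constantCoeff_logCoshSeries : constantCoeff logCoshSeries = 0 := by
  simp [logCoshSeries, ← PowerSeries.coeff_zero_eq_constantCoeff_apply,
    -PowerSeries.coeff_zero_eq_constantCoeff]

theorem derivative_logCoshSeries : d⁄dX ℚ logCoshSeries = tanhSeries := by
  ext n
  rw [PowerSeries.coeff_derivative, logCoshSeries, PowerSeries.coeff_mk, Nat.add_sub_cancel,
    Nat.cast_succ, div_mul_cancel₀ _ n.cast_add_one_ne_zero]

theorem evalNegHom_logCoshSeries : evalNegHom logCoshSeries = logCoshSeries := by
  refine PowerSeries.derivative.ext ?_ (constantCoeff_evalNegHom _)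
  rw [derivative_evalNegHom, derivative_logCoshSeries, evalNegHom_tanhSeries, neg_neg]

theorem eval_p_eq_factorial_mul_coeff (n x : ℕ) :
    (p n).eval (x : ℚ) = (n.factorial : ℚ) * PowerSeries.coeff n ((1 + tanhSeries) ^ (x + 1)) := by
  induction n generalizing x with
  | zero => simp [p_zero, constantCoeff_tanhSeries]
  | succ n ih =>
    have hode : d⁄dX ℚ ((1 + tanhSeries) ^ (x + 1)) = (x + 1 : ℚ) •
        (2 * (1 + tanhSeries) ^ (x + 1) - (1 + tanhSeries) ^ (x + 2)) := by
      rw [PowerSeries.derivative_pow, map_add, PowerSeries.derivative_one, derivative_tanhSeries,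
        Nat.add_sub_cancel, PowerSeries.smul_eq_C_mul]
      simp
      ring
    have hcoeff := congrArg (PowerSeries.coeff n) hode
    rw [PowerSeries.coeff_derivative, map_smul, map_sub, two_mul, map_add, smul_eq_mul] at hcoeff
    have hnext := ih (x + 1)
    push_cast at hnext
    rw [eval_p_succ, ih, hnext, Nat.factorial_succ]
    push_cast
    linear_combination -(n.factorial : ℚ) * hcoeff

theorem eval_derivative_p_eq_factorial_mul_coeff (n x : ℕ) :
    (derivative (p n)).eval (x : ℚ) = (n.factorial : ℚ) *
      PowerSeries.coeff n ((1 + tanhSeries) ^ (x + 1) * (PowerSeries.X - logCoshSeries)) := by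
  induction n generalizing x with
  | zero => simp [p_zero, constantCoeff_logCoshSeries]
  | succ n ih =>
    have hode : d⁄dX ℚ ((1 + tanhSeries) ^ (x + 1) * (PowerSeries.X - logCoshSeries)) =
        (2 * (1 + tanhSeries) ^ (x + 1) - (1 + tanhSeries) ^ (x + 2)) + (x + 1 : ℚ) •
        (2 * ((1 + tanhSeries) ^ (x + 1) * (PowerSeries.X - logCoshSeries)) -
          (1 + tanhSeries) ^ (x + 2) * (PowerSeries.X - logCoshSeries)) := by
      rw [Derivation.leibniz, PowerSeries.derivative_pow, map_add, map_sub,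
        PowerSeries.derivative_one, PowerSeries.derivative_X, derivative_tanhSeries,
        derivative_logCoshSeries, Nat.add_sub_cancel, PowerSeries.smul_eq_C_mul]
      simp
      ring
    have hcoeff := congrArg (PowerSeries.coeff n) hode
    rw [PowerSeries.coeff_derivative, map_add, map_smul, map_sub, map_sub, two_mul, two_mul,
      map_add, map_add, smul_eq_mul] at hcoeff
    have hnext := ih (x + 1)
    have hpnext := eval_p_eq_factorial_mul_coeff n (x + 1)
    push_cast at hnext hpnext
    rw [eval_derivative_p_succ, ih, hnext, eval_p_eq_factorial_mul_coeff, hpnext,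
      Nat.factorial_succ]
    push_cast
    linear_combination -(n.factorial : ℚ) * hcoeff

theorem dpZero_eq_sub_one_mul_eval_p {n : ℕ} (hn : 0 < n) (heven : Even n) :
    dpZero n = (n - 1) * (p (n - 1)).eval 0 := by
  obtain ⟨m, rfl⟩ := Nat.exists_eq_add_of_le' hn
  have hm : m ≠ 0 := by rintro rfl; simp at heven
  have hodd : PowerSeries.coeff (m + 1) (tanhSeries * logCoshSeries) = 0 :=
    coeff_eq_zero_of_evalNegHom_eq_neg
      (by rw [map_mul, evalNegHom_tanhSeries, evalNegHom_logCoshSeries, neg_mul]) heven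
  have hcoeff : PowerSeries.coeff (m + 1) ((1 + tanhSeries) * (PowerSeries.X - logCoshSeries)) =
      PowerSeries.coeff m tanhSeries - PowerSeries.coeff m tanhSeries / (m + 1) := by
    rw [show (1 + tanhSeries) * (PowerSeries.X - logCoshSeries) = PowerSeries.X +
        PowerSeries.X * tanhSeries - logCoshSeries - tanhSeries * logCoshSeries by ring,
      map_sub, map_sub, map_add, hodd, PowerSeries.coeff_succ_X_mul, PowerSeries.coeff_X,
      if_neg (by omega), logCoshSeries, PowerSeries.coeff_mk, Nat.add_sub_cancel]
    push_cast
    ring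
  have hp := eval_p_eq_factorial_mul_coeff m 0
  have hdp := eval_derivative_p_eq_factorial_mul_coeff (m + 1) 0
  rw [zero_add, pow_one, Nat.cast_zero, map_add, PowerSeries.coeff_one, if_neg hm, zero_add] at hp
  rw [zero_add, pow_one, Nat.cast_zero, hcoeff, Nat.factorial_succ] at hdp
  rw [dpZero, hdp, Nat.add_sub_cancel, hp]
  push_cast
  field_simp

end HyperbolicTangent

section PowerDifferences

open MeasureTheory Set

/-- The alternating differences `D_m(s) = (-1)^m Δ^m (x^(-s))` at `x = 1`, as functions of `s`. The
weighted sums of these over `m` interpolate the Dirichlet eta function and the functional `L*`. -/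
noncomputable def powDiff (m : ℕ) (s : ℂ) : ℂ :=
  (-1) ^ m * (fwdDiff 1)^[m] (fun k : ℕ => ((k : ℂ) + 1) ^ (-s)) 0

theorem powDiff_eq_sum (m : ℕ) (s : ℂ) :
    powDiff m s =
      ∑ k ∈ Finset.range (m + 1), (-1) ^ k * (m.choose k : ℂ) * ((k : ℂ) + 1) ^ (-s) := by
  simp [powDiff, neg_one_pow_mul_fwdDiff_iter_eq_sum]

theorem powDiff_eq_sub (m : ℕ) (s : ℂ) :
    powDiff m s = (m + 1) * powDiff m (s + 1) - m * powDiff (m - 1) (s + 1) := by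
  have hpow : (fun k : ℕ => ((k : ℂ) + 1) ^ (-s)) =
      fun k : ℕ => ((k : ℂ) + 1) * ((k : ℂ) + 1) ^ (-(s + 1)) := by
    funext k
    rw [neg_add, ← sub_eq_add_neg, Complex.cpow_sub _ _ (Nat.cast_add_one_ne_zero k),
      Complex.cpow_one, mul_div_cancel₀ _ (Nat.cast_add_one_ne_zero k)]
  rw [powDiff, hpow, fwdDiff_iter_affine_mul (c := 1) (fun k => by push_cast; ring)]
  cases m with
  | zero => simp [powDiff]
  | succ m =>
    rw [powDiff, powDiff, Nat.add_sub_cancel, Function.iterate_succ_apply', fwdDiff]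
    push_cast
    ring

theorem powDiff_zero_right (m : ℕ) : powDiff m 0 = if m = 0 then 1 else 0 := by
  have hbinom := add_pow (-1 : ℂ) 1 m
  simp only [one_pow, mul_one, neg_add_cancel, zero_pow_eq] at hbinom
  simp only [powDiff_eq_sum, neg_zero, Complex.cpow_zero, mul_one, ← hbinom]

theorem differentiable_powDiff (m : ℕ) : Differentiable ℂ (powDiff m) := by
  rw [funext (powDiff_eq_sum m)]
  exact Differentiable.fun_sum fun k _ => .const_mul
    (differentiable_neg.const_cpow (Or.inl (Nat.cast_add_one_ne_zero k))) _

theorem hasDerivAt_powDiff_zero (m : ℕ) : HasDerivAt (powDiff m) (2 ^ m * a m) 0 := by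
  have hsum : HasDerivAt (powDiff m) (∑ k ∈ Finset.range (m + 1),
      (-1) ^ k * (m.choose k : ℂ) * -Complex.log ((k : ℂ) + 1)) 0 := by
    rw [funext (powDiff_eq_sum m)]
    refine HasDerivAt.fun_sum fun k _ => HasDerivAt.const_mul _ ?_
    simpa using (hasDerivAt_neg (0 : ℂ)).const_cpow (c := (k : ℂ) + 1)
      (Or.inl (Nat.cast_add_one_ne_zero k))
  have ha : 2 ^ m * a m = -((-1) ^ m * (fwdDiff (1 : ℝ))^[m] Real.log 1) := by
    rw [a, pow_succ]
    field_simp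
  have ha' := congrArg ((↑) : ℝ → ℂ) ha
  rw [neg_one_pow_mul_fwdDiff_iter_eq_sum] at ha'
  push_cast at ha'
  rw [ha']
  refine hsum.congr_deriv ?_
  rw [← Finset.sum_neg_distrib]
  refine Finset.sum_congr rfl fun k _ => ?_
  rw [nsmul_one, Complex.ofReal_log (by positivity)]
  push_cast
  rw [add_comm (1 : ℂ), mul_neg]

theorem integral_cpow_mul_exp_neg_add_one_mul (k : ℕ) {s : ℂ} (hs : 0 < s.re) :
    ∫ t : ℝ in Ioi 0, (t : ℂ) ^ (s - 1) * Complex.exp (-(((k + 1 : ℕ) : ℝ) * t)) =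
      ((k : ℂ) + 1) ^ (-s) * Complex.Gamma s := by
  rw [Complex.integral_cpow_mul_exp_neg_mul_Ioi hs (by positivity), one_div, Complex.inv_cpow,
    Complex.cpow_neg]
  · push_cast
    rfl
  · rw [Complex.ofReal_natCast, Complex.natCast_arg]
    exact Real.pi_ne_zero.symm

theorem integrableOn_cpow_mul_exp_neg_mul {s : ℂ} (hs : 0 < s.re) {r : ℝ} (hr : 0 < r) :
    IntegrableOn (fun t : ℝ => (t : ℂ) ^ (s - 1) * Complex.exp (-(r * t))) (Ioi 0) := by
  -- The Bochner integral of a non-integrable function is `0`.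
  refine not_imp_comm.1 integral_undef ?_
  rw [Complex.integral_cpow_mul_exp_neg_mul_Ioi hs hr]
  refine mul_ne_zero ?_ (Complex.Gamma_ne_zero_of_re_pos hs)
  rw [Complex.cpow_ne_zero_iff_of_exponent_ne_zero (by rintro rfl; simp at hs)]
  exact one_div_ne_zero (by exact_mod_cast hr.ne')

theorem powDiff_mul_Gamma (m : ℕ) {s : ℂ} (hs : 0 < s.re) :
    powDiff m s * Complex.Gamma s =
      ∫ t : ℝ in Ioi 0, (t : ℂ) ^ (s - 1) * Complex.exp (-t) * (1 - Complex.exp (-t)) ^ m := by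
  have hexp (t : ℝ) : (t : ℂ) ^ (s - 1) * Complex.exp (-t) * (1 - Complex.exp (-t)) ^ m =
      ∑ k ∈ Finset.range (m + 1), (-1) ^ k * (m.choose k : ℂ) *
        ((t : ℂ) ^ (s - 1) * Complex.exp (-(((k + 1 : ℕ) : ℝ) * t))) := by
    rw [sub_eq_neg_add (1 : ℂ), add_pow, Finset.mul_sum]
    refine Finset.sum_congr rfl fun k _ => ?_
    have hmul : Complex.exp (-(((k + 1 : ℕ) : ℝ) * t)) = Complex.exp (-t) ^ (k + 1) := by
      rw [← Complex.exp_nat_mul]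
      push_cast
      ring_nf
    rw [hmul, neg_pow, one_pow]
    ring
  simp only [hexp]
  rw [integral_finsetSum _ fun k _ =>
    (integrableOn_cpow_mul_exp_neg_mul hs (by positivity)).const_mul _, powDiff_eq_sum,
    Finset.sum_mul]
  refine Finset.sum_congr rfl fun k _ => ?_
  rw [integral_const_mul, integral_cpow_mul_exp_neg_add_one_mul k hs, mul_assoc]

theorem norm_one_sub_exp_neg_le_one {t : ℝ} (ht : 0 ≤ t) : ‖1 - Complex.exp (-t)‖ ≤ 1 := by
  rw [← Complex.ofReal_neg, ← Complex.ofReal_exp, ← Complex.ofReal_one, ← Complex.ofReal_sub,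
    Complex.norm_real, Real.norm_eq_abs, abs_le]
  have hle : Real.exp (-t) ≤ 1 := Real.exp_le_one_iff.mpr (neg_nonpos.mpr ht)
  constructor <;> linarith [Real.exp_pos (-t)]

theorem norm_powDiff_mul_Gamma_le (m : ℕ) {s : ℂ} (hs : 0 < s.re) :
    ‖powDiff m s * Complex.Gamma s‖ ≤ Real.Gamma s.re := by
  rw [powDiff_mul_Gamma m hs, Real.Gamma_eq_integral hs]
  refine norm_integral_le_of_norm_le (Real.GammaIntegral_convergent hs) ?_
  refine (ae_restrict_iff' measurableSet_Ioi).mpr (Eventually.of_forall fun t (ht : 0 < t) => ?_)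
  have hkernel : ‖(t : ℂ) ^ (s - 1) * Complex.exp (-t)‖ = Real.exp (-t) * t ^ (s.re - 1) := by
    rw [norm_mul, Complex.norm_cpow_eq_rpow_re_of_pos ht, Complex.norm_exp]
    simp [mul_comm]
  rw [norm_mul, hkernel, norm_pow]
  exact mul_le_of_le_one_right (by positivity)
    (pow_le_one₀ (norm_nonneg _) (norm_one_sub_exp_neg_le_one ht.le))

theorem exists_norm_powDiff_le_of_one_le_re (R : ℝ) :
    ∃ C : ℝ, ∀ (m : ℕ) (s : ℂ), ‖s‖ ≤ R → 1 ≤ s.re → ‖powDiff m s‖ ≤ C := by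
  have hcompact : IsCompact (Metric.closedBall (0 : ℂ) R ∩ {s : ℂ | 1 ≤ s.re}) :=
    (isCompact_closedBall 0 R).inter_right (isClosed_le continuous_const Complex.continuous_re)
  have hcont : ContinuousOn (fun s : ℂ => Real.Gamma s.re * ‖(Complex.Gamma s)⁻¹‖)
      (Metric.closedBall (0 : ℂ) R ∩ {s : ℂ | 1 ≤ s.re}) := by
    rintro s ⟨-, hs⟩
    have hGamma : ContinuousAt Real.Gamma s.re :=
      (Real.differentiableOn_Gamma_Ioi.differentiableAt
        (Ioi_mem_nhds (zero_lt_one.trans_le hs))).continuousAt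
    exact ((hGamma.comp Complex.continuous_re.continuousAt).mul
      (Complex.differentiable_one_div_Gamma s).continuousAt.norm).continuousWithinAt
  obtain ⟨C, hC⟩ := hcompact.exists_bound_of_continuousOn hcont
  refine ⟨C, fun m s hR hs => ?_⟩
  have hpos : 0 < s.re := zero_lt_one.trans_le hs
  calc ‖powDiff m s‖ = ‖powDiff m s * Complex.Gamma s‖ * ‖(Complex.Gamma s)⁻¹‖ := by
        rw [← norm_mul, mul_inv_cancel_right₀ (Complex.Gamma_ne_zero_of_re_pos hpos)]
    _ ≤ Real.Gamma s.re * ‖(Complex.Gamma s)⁻¹‖ := by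
        gcongr
        exact norm_powDiff_mul_Gamma_le m hpos
    _ ≤ C := (le_abs_self _).trans (hC s ⟨mem_closedBall_zero_iff.mpr hR, hs⟩)

theorem norm_powDiff_le_of_norm_powDiff_add_one_le {C : ℝ} {M : ℕ} {s : ℂ}
    (h : ∀ m, ‖powDiff m (s + 1)‖ ≤ C * ((m : ℝ) + 1) ^ M) (m : ℕ) :
    ‖powDiff m s‖ ≤ 2 * C * ((m : ℝ) + 1) ^ (M + 1) := by
  have hC : 0 ≤ C := by simpa using (norm_nonneg _).trans (h 0)
  have hpred : ‖powDiff (m - 1) (s + 1)‖ ≤ C * ((m : ℝ) + 1) ^ M := by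
    refine (h (m - 1)).trans ?_
    gcongr
    exact m.sub_le 1
  have hsucc : ‖(m : ℂ) + 1‖ = (m : ℝ) + 1 := by exact_mod_cast Complex.norm_natCast (m + 1)
  rw [powDiff_eq_sub]
  calc _ ≤ ((m : ℝ) + 1) * ‖powDiff m (s + 1)‖ + m * ‖powDiff (m - 1) (s + 1)‖ := by
        refine (norm_sub_le _ _).trans_eq ?_
        rw [norm_mul, norm_mul, hsucc, Complex.norm_natCast]
    _ ≤ ((m : ℝ) + 1) * (C * ((m : ℝ) + 1) ^ M) + (m + 1) * (C * ((m : ℝ) + 1) ^ M) := by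
        gcongr
        · exact h m
        · exact le_add_of_nonneg_right zero_le_one
    _ = 2 * C * ((m : ℝ) + 1) ^ (M + 1) := by ring

theorem exists_norm_powDiff_le_of_one_sub_le_re (M : ℕ) (R : ℝ) :
    ∃ C : ℝ, ∀ (m : ℕ) (s : ℂ), ‖s‖ ≤ R → 1 - M ≤ s.re →
      ‖powDiff m s‖ ≤ C * ((m : ℝ) + 1) ^ M := by
  induction M generalizing R with
  | zero => simpa using exists_norm_powDiff_le_of_one_le_re R
  | succ M ih =>
    obtain ⟨C, hC⟩ := ih (R + 1)
    refine ⟨2 * C, fun m s hR hs => norm_powDiff_le_of_norm_powDiff_add_one_le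
      (fun k => hC k (s + 1) ?_ ?_) m⟩
    · exact (norm_add_le _ _).trans (by simpa using hR)
    · push_cast at hs
      rw [Complex.add_re, Complex.one_re]
      linarith

theorem exists_norm_powDiff_le (R : ℝ) :
    ∃ (M : ℕ) (C : ℝ), ∀ (m : ℕ) (s : ℂ), ‖s‖ ≤ R → ‖powDiff m s‖ ≤ C * ((m : ℝ) + 1) ^ M := by
  obtain ⟨M, hM⟩ := exists_nat_ge (R + 1)
  obtain ⟨C, hC⟩ := exists_norm_powDiff_le_of_one_sub_le_re M R
  refine ⟨M, C, fun m s hs => hC m s hs ?_⟩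
  linarith [(abs_le.mp ((Complex.abs_re_le_norm s).trans hs)).1]

end PowerDifferences

section HasseSeries

theorem summable_norm_pow_mul_eval {r : ℂ} (hr : ‖r‖ < 1) (f : ℂ[X]) :
    Summable fun m : ℕ => ‖r ^ m * f.eval (m : ℂ)‖ := by
  induction f using Polynomial.induction_on' with
  | add f g hf hg =>
    refine Summable.of_nonneg_of_le (fun m => norm_nonneg _) (fun m => ?_) (hf.add hg)
    rw [eval_add, mul_add]
    exact norm_add_le _ _
  | monomial n c =>
    refine ((summable_norm_pow_mul_geometric_of_norm_lt_one n hr).mul_left ‖c‖).congr fun m => ?_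
    rw [eval_monomial, ← norm_mul]
    ring_nf

/-- The entire function `B_f(s) = ∑ 2^(-m) f(m) D_m(s)`, with `D_m` being `powDiff m`. For `f = 1`
it is Hasse's globally convergent series for twice the Dirichlet eta function. -/
noncomputable def hasseSeries (f : ℂ[X]) (s : ℂ) : ℂ :=
  ∑' m : ℕ, (1 / 2 : ℂ) ^ m * f.eval (m : ℂ) * powDiff m s

theorem exists_summable_bound_hasseSeries (f : ℂ[X]) (R : ℝ) :
    ∃ u : ℕ → ℝ, Summable u ∧ ∀ (m : ℕ) (s : ℂ), s ∈ Metric.ball (0 : ℂ) R →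
      ‖(1 / 2 : ℂ) ^ m * f.eval (m : ℂ) * powDiff m s‖ ≤ u m := by
  obtain ⟨M, C, hC⟩ := exists_norm_powDiff_le R
  have hhalf : ‖(1 / 2 : ℂ)‖ < 1 := by norm_num
  refine ⟨fun m => C * ‖(1 / 2 : ℂ) ^ m * (f * ((X : ℂ[X]) + 1) ^ M).eval (m : ℂ)‖,
    (summable_norm_pow_mul_eval hhalf _).mul_left C, fun m s hs => ?_⟩
  have hsucc : ‖(m : ℂ) + 1‖ = (m : ℝ) + 1 := by exact_mod_cast Complex.norm_natCast (m + 1)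
  rw [norm_mul]
  refine (mul_le_mul_of_nonneg_left (hC m s (mem_ball_zero_iff.mp hs).le)
    (norm_nonneg _)).trans_eq ?_
  simp only [eval_mul, eval_pow, eval_add, eval_X, eval_one, norm_mul, norm_pow, hsucc]
  ring

theorem summable_hasseSeries (f : ℂ[X]) (s : ℂ) :
    Summable fun m : ℕ => (1 / 2 : ℂ) ^ m * f.eval (m : ℂ) * powDiff m s := by
  obtain ⟨u, hu, hbound⟩ := exists_summable_bound_hasseSeries f (‖s‖ + 1)
  exact .of_norm_bounded hu fun m => hbound m s (by simp)

theorem differentiable_hasseSeries (f : ℂ[X]) : Differentiable ℂ (hasseSeries f) := by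
  intro s
  obtain ⟨u, hu, hbound⟩ := exists_summable_bound_hasseSeries f (‖s‖ + 1)
  exact (Complex.differentiableOn_tsum_of_summable_norm hu
    (fun m => ((differentiable_powDiff m).const_mul _).differentiableOn) Metric.isOpen_ball
    hbound).differentiableAt (Metric.isOpen_ball.mem_nhds (by simp))

theorem hasSum_a_mul_eval (f : ℂ[X]) :
    HasSum (fun m : ℕ => (a m : ℂ) * f.eval (m : ℂ)) (deriv (hasseSeries f) 0) := by
  obtain ⟨u, hu, hbound⟩ := exists_summable_bound_hasseSeries f 1
  refine (Complex.hasSum_deriv_of_summable_norm hu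
    (fun m => ((differentiable_powDiff m).const_mul _).differentiableOn) Metric.isOpen_ball
    hbound (Metric.mem_ball_self one_pos)).congr_fun fun m => ?_
  rw [((hasDerivAt_powDiff_zero m).const_mul _).deriv, one_div, inv_pow]
  field_simp

theorem hasSum_a_succ_mul_eval (f : ℂ[X]) :
    HasSum (fun n : ℕ => (a (n + 1) : ℂ) * f.eval ((n + 1 : ℕ) : ℂ))
      (deriv (hasseSeries f) 0) := by
  have ha : a 0 = 0 := by simp [a]
  simpa [ha] using (hasSum_nat_add_iff' 1).mpr (hasSum_a_mul_eval f)

theorem LStar_eq_deriv_hasseSeries (f : ℂ[X]) : LStar f = deriv (hasseSeries f) 0 :=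
  (hasSum_a_succ_mul_eval f).tsum_eq

theorem hasseSeries_zero_right (f : ℂ[X]) : hasseSeries f 0 = f.eval 0 := by
  rw [hasseSeries, tsum_eq_single 0 fun m hm => by simp [powDiff_zero_right, hm]]
  simp [powDiff_zero_right]

/- Summation by parts: the terms are `2 u m - 2 v (m + 1)` on the left and `2 (u m - v m)` on the
right, and `v 0 = 0`. -/
theorem hasseSeries_raise (f : ℂ[X]) (s : ℂ) :
    hasseSeries (raise f) s = 2 * hasseSeries f (s - 1) := by
  set u : ℕ → ℂ := fun m => (1 / 2 : ℂ) ^ m * ((X + 1) * f).eval (m : ℂ) * powDiff m s with hu_def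
  set v : ℕ → ℂ := fun m => (1 / 2 : ℂ) ^ m * f.eval (m : ℂ) * (m * powDiff (m - 1) s) with hv_def
  have hleft (m : ℕ) :
      (1 / 2 : ℂ) ^ m * (raise f).eval (m : ℂ) * powDiff m s = 2 * u m - 2 * v (m + 1) := by
    simp [hu_def, hv_def, raise, taylor_eval, pow_succ]
    ring
  have hright (m : ℕ) :
      (1 / 2 : ℂ) ^ m * f.eval (m : ℂ) * powDiff m (s - 1) = u m - v m := by
    rw [powDiff_eq_sub m (s - 1), sub_add_cancel]
    simp [hu_def, hv_def]
    ring
  have hu : Summable u := summable_hasseSeries _ s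
  have hv : Summable v :=
    (hu.sub (summable_hasseSeries f (s - 1))).congr fun m => by rw [hright]; ring
  have hv_succ : Summable fun m => v (m + 1) := (summable_nat_add_iff 1).mpr hv
  have hv_tsum : ∑' m, v m = ∑' m, v (m + 1) := by
    rw [hv.tsum_eq_zero_add]
    simp [hv_def]
  simp only [hasseSeries, hleft, hright]
  rw [(hu.mul_left 2).tsum_sub (hv_succ.mul_left 2), hu.tsum_sub hv, tsum_mul_left,
    tsum_mul_left, hv_tsum]
  ring

theorem hasseSeries_map_p (n : ℕ) (s : ℂ) :
    hasseSeries ((p n).map (algebraMap ℚ ℂ)) s = 2 ^ n * hasseSeries 1 (s - n) := by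
  induction n generalizing s with
  | zero => simp [p_zero]
  | succ n ih =>
    rw [p_succ, map_raise, hasseSeries_raise, ih, sub_sub, pow_succ', Nat.cast_succ, mul_assoc,
      add_comm (1 : ℂ)]

end HasseSeries

section EulerTransformation

theorem hasSum_choose_mul_half_pow (k : ℕ) :
    HasSum (fun m : ℕ => (m.choose k : ℝ) * (1 / 2) ^ m) 2 := by
  have hzero : ∑ m ∈ Finset.range k, (m.choose k : ℝ) * (1 / 2) ^ m = 0 :=
    Finset.sum_eq_zero fun m hm => by simp [Nat.choose_eq_zero_of_lt (Finset.mem_range.mp hm)]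
  have hgeom := (hasSum_choose_mul_geometric_of_norm_lt_one (𝕜 := ℝ) k (r := 1 / 2)
    (by norm_num)).mul_right ((1 / 2) ^ k)
  have hvalue : 1 / (1 - 1 / 2 : ℝ) ^ (k + 1) * (1 / 2) ^ k = 2 := by
    rw [pow_succ]
    field_simp
    norm_num
  rw [hvalue] at hgeom
  rw [← hasSum_nat_add_iff' k, hzero, sub_zero]
  exact hgeom.congr_fun fun m => by rw [pow_add, mul_assoc]

theorem tsum_half_pow_smul_sum_choose_smul {E : Type*} [NormedAddCommGroup E] [NormedSpace ℝ E]
    [CompleteSpace E] {b : ℕ → E} (hb : Summable fun k => ‖b k‖) :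
    ∑' m : ℕ, (1 / 2 : ℝ) ^ m • ∑ k ∈ Finset.range (m + 1), (m.choose k : ℝ) • b k =
      (2 : ℝ) • ∑' k, b k := by
  set F : ℕ → ℕ → E := fun k m => ((m.choose k : ℝ) * (1 / 2) ^ m) • b k with hF_def
  have hF_norm (k : ℕ) : HasSum (fun m => ‖F k m‖) (2 * ‖b k‖) := by
    refine ((hasSum_choose_mul_half_pow k).mul_right _).congr_fun fun m => ?_
    rw [hF_def, norm_smul, Real.norm_of_nonneg (by positivity)]
  have hF_summable : Summable (Function.uncurry F) := by
    refine .of_norm ((summable_prod_of_nonneg fun _ => norm_nonneg _).mpr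
      ⟨fun k => (hF_norm k).summable, ?_⟩)
    exact (hb.mul_left 2).congr fun k => (hF_norm k).tsum_eq.symm
  have hF_row (m : ℕ) :
      (1 / 2 : ℝ) ^ m • ∑ k ∈ Finset.range (m + 1), (m.choose k : ℝ) • b k = ∑' k, F k m := by
    rw [tsum_eq_sum (s := Finset.range (m + 1)), Finset.smul_sum]
    · exact Finset.sum_congr rfl fun k _ => by rw [smul_smul, mul_comm]
    · intro k hk
      simp [hF_def, Nat.choose_eq_zero_of_lt (not_le.mp (Finset.mem_range_succ_iff.not.mp hk))]
  have hF_column (k : ℕ) : ∑' m, F k m = (2 : ℝ) • b k :=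
    ((hasSum_choose_mul_half_pow k).smul_const (b k)).tsum_eq
  simp only [hF_row]
  rw [hF_summable.tsum_comm]
  simp only [hF_column]
  exact tsum_const_smul'' _

theorem tsum_neg_one_pow_mul {R : Type*} [NormedRing R] [CompleteSpace R] {g : ℕ → R}
    (hg : Summable g) :
    ∑' k, (-1) ^ k * g k = ∑' k, g k - 2 * ∑' k, g (2 * k + 1) := by
  have heven : Summable fun k => g (2 * k) := hg.comp_injective fun _ _ h => by simpa using h
  have hodd : Summable fun k => g (2 * k + 1) := hg.comp_injective fun _ _ h => by simpa using h
  have hsplit : ∑' k, (-1) ^ k * g k = ∑' k, g (2 * k) - ∑' k, g (2 * k + 1) := by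
    rw [← tsum_even_add_odd (f := fun k => (-1) ^ k * g k) (by simpa using heven)
      (by simpa [pow_succ] using hodd.neg)]
    simp [pow_succ, tsum_neg, sub_eq_add_neg]
  rw [hsplit, ← tsum_even_add_odd heven hodd, two_mul]
  abel

end EulerTransformation

section DirichletEta

/-- The Dirichlet eta function `η(s) = (1 - 2^(1 - s)) ζ(s) = ∑ (-1)^k (k + 1)^(-s)`. At the
removable singularity `s = 1` it takes the value `0` instead of `log 2`. -/
noncomputable def dirichletEta (s : ℂ) : ℂ :=
  (1 - 2 ^ (1 - s)) * riemannZeta s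

theorem summable_natCast_add_one_cpow_neg {s : ℂ} (hs : 1 < s.re) :
    Summable fun k : ℕ => ((k : ℂ) + 1) ^ (-s) := by
  simpa [Complex.cpow_neg] using
    (summable_nat_add_iff 1).mpr (Complex.summable_one_div_nat_cpow.mpr hs)

theorem tsum_neg_one_pow_mul_natCast_add_one_cpow_neg {s : ℂ} (hs : 1 < s.re) :
    ∑' k : ℕ, (-1) ^ k * ((k : ℂ) + 1) ^ (-s) = dirichletEta s := by
  have hzeta : riemannZeta s = ∑' k : ℕ, ((k : ℂ) + 1) ^ (-s) := by
    simp only [zeta_eq_tsum_one_div_nat_add_one_cpow hs, Complex.cpow_neg, one_div]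
  have hodd (k : ℕ) : (((2 * k + 1 : ℕ) : ℂ) + 1) ^ (-s) = 2 ^ (-s) * ((k : ℂ) + 1) ^ (-s) := by
    have hmul := Complex.natCast_mul_natCast_cpow 2 (k + 1) (-s)
    push_cast at hmul ⊢
    rw [← hmul]
    ring_nf
  rw [tsum_neg_one_pow_mul (summable_natCast_add_one_cpow_neg hs)]
  simp only [hodd]
  rw [tsum_mul_left, ← hzeta, dirichletEta, sub_eq_add_neg 1 s, Complex.cpow_add _ _ two_ne_zero,
    Complex.cpow_one]
  ring

theorem hasseSeries_one_of_one_lt_re {s : ℂ} (hs : 1 < s.re) :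
    hasseSeries 1 s = 2 * dirichletEta s := by
  have hsummable : Summable fun k : ℕ => ‖(-1) ^ k * ((k : ℂ) + 1) ^ (-s)‖ := by
    simpa using (summable_natCast_add_one_cpow_neg hs).norm
  have heuler := tsum_half_pow_smul_sum_choose_smul hsummable
  rw [tsum_neg_one_pow_mul_natCast_add_one_cpow_neg hs] at heuler
  simp only [Complex.real_smul] at heuler
  push_cast at heuler
  rw [← heuler, hasseSeries]
  refine tsum_congr fun m => ?_
  rw [powDiff_eq_sum, eval_one, mul_one]
  congr 1
  exact Finset.sum_congr rfl fun k _ => by ring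

theorem differentiableAt_one_sub_two_cpow (s : ℂ) :
    DifferentiableAt ℂ (fun s : ℂ => 1 - (2 : ℂ) ^ (1 - s)) s :=
  ((differentiableAt_id.const_sub 1).const_cpow (Or.inl two_ne_zero)).const_sub 1

theorem hasseSeries_one {s : ℂ} (hs : s ≠ 1) : hasseSeries 1 s = 2 * dirichletEta s := by
  have hhasse : AnalyticOnNhd ℂ (hasseSeries 1) {1}ᶜ :=
    (differentiable_hasseSeries 1).differentiableOn.analyticOnNhd isOpen_compl_singleton
  have heta : AnalyticOnNhd ℂ (fun s => 2 * dirichletEta s) {1}ᶜ :=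
    DifferentiableOn.analyticOnNhd (fun z hz => (((differentiableAt_one_sub_two_cpow z).mul
      (differentiableAt_riemannZeta hz)).const_mul 2).differentiableWithinAt) isOpen_compl_singleton
  have hnear : hasseSeries 1 =ᶠ[𝓝 2] fun s => 2 * dirichletEta s :=
    Filter.mem_of_superset ((isOpen_lt continuous_const Complex.continuous_re).mem_nhds
      (by simp : (1 : ℝ) < (2 : ℂ).re)) fun z hz => hasseSeries_one_of_one_lt_re hz
  exact hhasse.eqOn_of_preconnected_of_eventuallyEq heta
    (isConnected_compl_singleton_of_one_lt_rank (by simp) 1).isPreconnected (by simp) hnear hs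

theorem hasDerivAt_dirichletEta_of_riemannZeta_eq_zero {s : ℂ} (hs : s ≠ 1)
    (hzero : riemannZeta s = 0) :
    HasDerivAt dirichletEta ((1 - 2 ^ (1 - s)) * deriv riemannZeta s) s := by
  have hmul := (differentiableAt_one_sub_two_cpow s).hasDerivAt.mul
    (differentiableAt_riemannZeta hs).hasDerivAt
  rwa [hzero, mul_zero, zero_add] at hmul

end DirichletEta

section SpecialValues

theorem ne_neg_natCast_of_re_pos {s : ℂ} (hs : 0 < s.re) (n : ℕ) : s ≠ -n := fun h => by
  rw [h] at hs
  simp only [Complex.neg_re, Complex.natCast_re] at hs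
  linarith [n.cast_nonneg (α := ℝ)]

theorem neg_natCast_ne_one (n : ℕ) : -(n : ℂ) ≠ 1 :=
  (ne_neg_natCast_of_re_pos (s := 1) (by simp) n).symm

theorem two_cpow_one_sub_neg_natCast (n : ℕ) : (2 : ℂ) ^ (1 - -(n : ℂ)) = 2 ^ (n + 1) := by
  rw [sub_neg_eq_add, add_comm]
  exact_mod_cast Complex.cpow_natCast 2 (n + 1)

theorem eval_zero_p (n : ℕ) :
    (((p n).eval 0 : ℚ) : ℂ) = 2 ^ (n + 1) * (1 - 2 ^ (n + 1)) * riemannZeta (-n) := by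
  have hmap : (((p n).eval 0 : ℚ) : ℂ) = ((p n).map (algebraMap ℚ ℂ)).eval 0 := by
    simpa using (eval_map_apply (algebraMap ℚ ℂ) (0 : ℚ) (p := p n)).symm
  rw [hmap, ← hasseSeries_zero_right, hasseSeries_map_p, zero_sub,
    hasseSeries_one (neg_natCast_ne_one n), dirichletEta, two_cpow_one_sub_neg_natCast]
  ring

theorem LStarRat_p {n : ℕ} (hzero : riemannZeta (-n) = 0) :
    LStarRat (p n) = 2 ^ (n + 1) * (1 - 2 ^ (n + 1)) * deriv riemannZeta (-n) := by
  have hhasse : hasseSeries 1 =ᶠ[𝓝 (-n : ℂ)] fun s => 2 * dirichletEta s :=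
    Filter.mem_of_superset (isOpen_compl_singleton.mem_nhds (neg_natCast_ne_one n))
      fun s hs => hasseSeries_one hs
  have hderiv : HasDerivAt (hasseSeries 1)
      (2 * ((1 - 2 ^ (n + 1)) * deriv riemannZeta (-n))) (0 - n) := by
    have heta := hasDerivAt_dirichletEta_of_riemannZeta_eq_zero (neg_natCast_ne_one n) hzero
    rw [two_cpow_one_sub_neg_natCast] at heta
    rw [zero_sub]
    exact (heta.const_mul 2).congr_of_eventuallyEq hhasse
  rw [LStarRat, LStar_eq_deriv_hasseSeries, funext (hasseSeries_map_p n),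
    ((hderiv.comp_sub_const 0 (n : ℂ)).const_mul (2 ^ n)).deriv]
  ring

end SpecialValues

section FunctionalEquation

open scoped Real

theorem riemannZeta_one_sub_of_one_lt_re {s : ℂ} (hs : 1 < s.re) :
    riemannZeta (1 - s) =
      2 * (2 * π) ^ (-s) * Complex.Gamma s * Complex.cos (π * s / 2) * riemannZeta s :=
  riemannZeta_one_sub (ne_neg_natCast_of_re_pos (one_pos.trans hs)) fun h => by simp [h] at hs

theorem deriv_riemannZeta_one_sub {s : ℂ} (hs : 1 < s.re) (hcos : Complex.cos (π * s / 2) = 0) :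
    deriv riemannZeta (1 - s) =
      π * (2 * π) ^ (-s) * Complex.Gamma s * Complex.sin (π * s / 2) * riemannZeta s := by
  have hs_ne : s ≠ 1 := fun h => by simp [h] at hs
  have hs_ne' : 1 - s ≠ 1 := fun h => by
    norm_num [sub_eq_self.mp h] at hs
  have hfactor : DifferentiableAt ℂ
      (fun s => 2 * (2 * π : ℂ) ^ (-s) * Complex.Gamma s * riemannZeta s) s :=
    (((differentiableAt_id.neg.const_cpow (Or.inl (by simp [Real.pi_ne_zero]))).const_mul 2).mul
      (Complex.differentiableAt_Gamma s (ne_neg_natCast_of_re_pos (one_pos.trans hs)))).mul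
      (differentiableAt_riemannZeta hs_ne)
  have hcos_deriv : HasDerivAt (fun s : ℂ => Complex.cos (π * s / 2))
      (-Complex.sin (π * s / 2) * (π / 2)) s := by
    simpa using (((hasDerivAt_id s).const_mul (π : ℂ)).div_const 2).ccos
  have hleft : HasDerivAt (fun s => riemannZeta (1 - s)) (-deriv riemannZeta (1 - s)) s :=
    (differentiableAt_riemannZeta hs_ne').hasDerivAt.comp_const_sub 1 s
  have hequation : (fun s => riemannZeta (1 - s)) =ᶠ[𝓝 s]
      (fun s => 2 * (2 * π : ℂ) ^ (-s) * Complex.Gamma s * riemannZeta s) *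
        fun s => Complex.cos (π * s / 2) :=
    Filter.mem_of_superset ((isOpen_lt continuous_const Complex.continuous_re).mem_nhds hs)
      fun z hz => (riemannZeta_one_sub_of_one_lt_re hz).trans (by simp only [Pi.mul_apply]; ring)
  have hright := (hfactor.hasDerivAt.mul hcos_deriv).congr_of_eventuallyEq hequation
  linear_combination -hleft.unique hright - deriv
    (fun s => 2 * (2 * π : ℂ) ^ (-s) * Complex.Gamma s * riemannZeta s) s * hcos

theorem four_mul_deriv_riemannZeta_neg {s : ℂ} (hs : 1 < s.re)
    (hsin : Complex.sin (π * s / 2) = 0) :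
    4 * deriv riemannZeta (-s) * riemannZeta s =
      s * riemannZeta (s + 1) * riemannZeta (1 - s) := by
  have hangle : (π * (s + 1) / 2 : ℂ) = π * s / 2 + π / 2 := by ring
  have hpi : (2 * π : ℂ) ≠ 0 := by simp [Real.pi_ne_zero]
  have hs_ne : s ≠ 0 := fun h => by norm_num [h] at hs
  have hderiv := deriv_riemannZeta_one_sub (s := s + 1) (by simp; linarith)
    (by rw [hangle, Complex.cos_add_pi_div_two, hsin, neg_zero])
  have hpow : (2 * π : ℂ) ^ (-(s + 1)) * (2 * π) = (2 * π) ^ (-s) := by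
    rw [neg_add, Complex.cpow_add _ _ hpi, Complex.cpow_neg_one, inv_mul_cancel_right₀ hpi]
  rw [hangle, Complex.sin_add_pi_div_two, Complex.Gamma_add_one s hs_ne, sub_add_cancel_right]
    at hderiv
  rw [hderiv, riemannZeta_one_sub_of_one_lt_re hs, ← hpow]
  ring

theorem riemannZeta_one_sub_ne_zero {s : ℂ} (hs : 1 < s.re)
    (hsin : Complex.sin (π * s / 2) = 0) : riemannZeta (1 - s) ≠ 0 := by
  have hcos : Complex.cos (π * s / 2) ≠ 0 := fun h => by
    simpa [hsin, h] using Complex.sin_sq_add_cos_sq (π * s / 2)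
  have hpow : (2 * π : ℂ) ^ (-s) ≠ 0 := by simp [Complex.cpow_eq_zero_iff, Real.pi_ne_zero]
  have hGamma : Complex.Gamma s ≠ 0 := Complex.Gamma_ne_zero_of_re_pos (one_pos.trans hs)
  have hzeta : riemannZeta s ≠ 0 := riemannZeta_ne_zero_of_one_le_re hs.le
  rw [riemannZeta_one_sub_of_one_lt_re hs]
  simp [hcos, hpow, hGamma, hzeta]

end FunctionalEquation

section Quotient

open scoped Real

theorem one_lt_of_pos_of_even {n : ℕ} (hn : 0 < n) (heven : Even n) : 1 < n := by
  obtain ⟨m, rfl⟩ := heven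
  omega

theorem sin_pi_mul_div_two_of_even {n : ℕ} (heven : Even n) :
    Complex.sin (π * (n : ℂ) / 2) = 0 := by
  obtain ⟨m, rfl⟩ := heven.exists_two_nsmul
  convert Complex.sin_nat_mul_pi m using 2
  simp
  ring

theorem riemannZeta_neg_of_even {n : ℕ} (hn : 0 < n) (heven : Even n) : riemannZeta (-n) = 0 := by
  obtain ⟨m, rfl⟩ := heven.exists_two_nsmul
  obtain ⟨k, rfl⟩ := Nat.exists_eq_add_one.mpr (pos_of_mul_pos_right hn two_pos.le)
  simpa using riemannZeta_neg_two_mul_nat_add_one k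

theorem dpZero_eq_riemannZeta {n : ℕ} (hn : 0 < n) (heven : Even n) :
    (dpZero n : ℂ) = (n - 1) * (2 ^ n * (1 - 2 ^ n) * riemannZeta (1 - n)) := by
  have hvalue := eval_zero_p (n - 1)
  rw [Nat.sub_add_cancel hn, Nat.cast_sub hn, Nat.cast_one, neg_sub] at hvalue
  rw [dpZero_eq_sub_one_mul_eval_p hn heven]
  push_cast
  rw [hvalue]

theorem one_sub_two_pow_ne_zero {n : ℕ} (hn : n ≠ 0) : (1 - 2 ^ n : ℂ) ≠ 0 :=
  sub_ne_zero.mpr (mod_cast (Nat.one_lt_two_pow hn).ne)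

theorem dpZero_ne_zero {n : ℕ} (hn : 0 < n) (heven : Even n) : dpZero n ≠ 0 := by
  have hn_one := one_lt_of_pos_of_even hn heven
  have hzeta : riemannZeta (1 - n) ≠ 0 :=
    riemannZeta_one_sub_ne_zero (by simpa) (sin_pi_mul_div_two_of_even heven)
  have hpow := one_sub_two_pow_ne_zero hn.ne'
  have hn_sub : (n : ℂ) - 1 ≠ 0 := sub_ne_zero.mpr (mod_cast hn_one.ne')
  have hcast : (dpZero n : ℂ) ≠ 0 := by
    simp [dpZero_eq_riemannZeta hn heven, hzeta, hpow, hn_sub]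
  exact_mod_cast hcast

/-- The rational factor `(1 - 1/n) (1 - 1/(2^(n+1) - 1))` by which `ζ(n + 1) / ζ(n)` differs from
`L*(p_n) / p_n'(0)`. -/
def quotientFactor (n : ℕ) : ℚ :=
  (1 - 1 / n) * (1 - 1 / (2 ^ (n + 1) - 1))

theorem quotientFactor_ne_zero {n : ℕ} (hn : 1 < n) : quotientFactor n ≠ 0 := by
  have hpow : (2 : ℚ) < 2 ^ (n + 1) := by
    simpa using pow_lt_pow_right₀ (one_lt_two (α := ℚ)) (show 1 < n + 1 by omega)
  have hn_inv : 1 / (n : ℚ) < 1 := (div_lt_one (by positivity)).mpr (mod_cast hn)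
  have hpow_inv : 1 / ((2 : ℚ) ^ (n + 1) - 1) < 1 := (div_lt_one (by linarith)).mpr (by linarith)
  exact mul_ne_zero (sub_pos.mpr hn_inv).ne' (sub_pos.mpr hpow_inv).ne'

theorem riemannZeta_add_one_div_riemannZeta {n : ℕ} (hn : 0 < n) (heven : Even n) :
    riemannZeta (n + 1) / riemannZeta n = quotientFactor n * (LStarRat (p n) / dpZero n) := by
  have hn_one := one_lt_of_pos_of_even hn heven
  have hn_re : 1 < (n : ℂ).re := by simpa
  have hsin := sin_pi_mul_div_two_of_even heven
  have hn_ne : (n : ℂ) ≠ 0 := mod_cast hn.ne'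
  have hn_sub : (n : ℂ) - 1 ≠ 0 := sub_ne_zero.mpr (mod_cast hn_one.ne')
  have hzeta : riemannZeta n ≠ 0 := riemannZeta_ne_zero_of_one_le_re hn_re.le
  have hzeta' : riemannZeta (1 - n) ≠ 0 := riemannZeta_one_sub_ne_zero hn_re hsin
  have hpow := one_sub_two_pow_ne_zero hn.ne'
  have hpow' : (2 : ℂ) ^ (n + 1) - 1 ≠ 0 :=
    neg_sub (1 : ℂ) _ ▸ neg_ne_zero.mpr (one_sub_two_pow_ne_zero n.succ_ne_zero)
  have hderiv : deriv riemannZeta (-n) =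
      n * riemannZeta (n + 1) * riemannZeta (1 - n) / (4 * riemannZeta n) := by
    rw [eq_div_iff (by simpa), ← four_mul_deriv_riemannZeta_neg hn_re hsin]
    ring
  rw [LStarRat_p (riemannZeta_neg_of_even hn heven), hderiv, dpZero_eq_riemannZeta hn heven,
    quotientFactor]
  push_cast
  rw [pow_succ] at hpow' ⊢
  field_simp
  ring

end Quotient

section Limit

theorem tendsto_riemannZeta_natCast : Tendsto (fun n : ℕ => riemannZeta n) atTop (𝓝 1) := by
  have hseries := LSeries.tendsto_atTop (f := 1)
    (by simpa [LSeries.abscissaOfAbsConv_one] using EReal.coe_lt_top 1)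
  refine (hseries.comp tendsto_natCast_atTop_atTop).congr' ?_
  filter_upwards [eventually_gt_atTop 1] with n hn
  simpa using LSeries_one_eq_riemannZeta (s := n) (by simpa)

theorem tendsto_quotientFactor : Tendsto quotientFactor atTop (𝓝 1) := by
  have hn : Tendsto (fun n : ℕ => 1 / (n : ℚ)) atTop (𝓝 0) := tendsto_one_div_atTop_nhds_zero_nat
  have hpow : Tendsto (fun n : ℕ => 1 / ((2 : ℚ) ^ (n + 1) - 1)) atTop (𝓝 0) := by
    simp only [one_div, sub_eq_add_neg]
    exact ((tendsto_atTop_add_const_right atTop (-1 : ℚ)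
      (tendsto_pow_atTop_atTop_of_one_lt one_lt_two)).comp
      (tendsto_add_atTop_nat 1)).inv_tendsto_atTop
  have hmul := (hn.const_sub 1).mul (hpow.const_sub 1)
  rwa [sub_zero, mul_one] at hmul

theorem tendsto_LStarRat_p_div_dpZero :
    Tendsto (fun n : ℕ => LStarRat (p n) / (dpZero n : ℂ)) (atTop ⊓ 𝓟 {n : ℕ | Even n}) (𝓝 1) := by
  have hzeta_succ : Tendsto (fun n : ℕ => riemannZeta (n + 1)) atTop (𝓝 1) := by
    simpa using (tendsto_add_atTop_iff_nat 1).mpr tendsto_riemannZeta_natCast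
  have hfactor : Tendsto (fun n => (quotientFactor n : ℂ)) atTop (𝓝 1) :=
    ((Complex.continuous_ofReal.comp Rat.continuous_coe_real).tendsto' 1 1 (by simp)).comp
      tendsto_quotientFactor |>.congr fun n => by simp
  have hquotient := (hzeta_succ.div tendsto_riemannZeta_natCast one_ne_zero).div hfactor one_ne_zero
  rw [div_one, div_one] at hquotient
  refine (hquotient.mono_left inf_le_left).congr' (eventually_inf_principal.mpr ?_)
  filter_upwards [eventually_gt_atTop 0] with n hn heven
  have hfactor_ne : (quotientFactor n : ℂ) ≠ 0 :=
    mod_cast quotientFactor_ne_zero (one_lt_of_pos_of_even hn heven)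
  simp only [Pi.div_apply]
  rw [riemannZeta_add_one_div_riemannZeta hn heven, mul_div_cancel_left₀ _ hfactor_ne]

end Limit

section LinearCombinations

theorem LStarRat_sum_smul {ι : Type*} (s : Finset ι) (c : ι → ℚ) (f : ι → ℚ[X]) :
    LStarRat (∑ i ∈ s, c i • f i) = ∑ i ∈ s, (c i : ℂ) * LStarRat (f i) := by
  have hsum := hasSum_sum (s := s) fun i _ =>
    (hasSum_a_succ_mul_eval ((f i).map (algebraMap ℚ ℂ))).mul_left (c i : ℂ)
  simp only [LStarRat, LStar_eq_deriv_hasseSeries ((f _).map _)]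
  refine (hsum.congr_fun fun n => ?_).tsum_eq
  simp only [Polynomial.map_sum, Polynomial.map_smul, eval_finsetSum, eval_smul, smul_eq_mul,
    eq_ratCast, Finset.mul_sum]
  exact Finset.sum_congr rfl fun i _ => by ring

theorem natDegree_sum_smul_of_strictMono {R : Type*} [Semiring R] [IsDomain R] {N : ℕ}
    {c : Fin (N + 1) → R} {f : Fin (N + 1) → R[X]} (hc : c (Fin.last N) ≠ 0)
    (hf : StrictMono fun j => (f j).natDegree) :
    (∑ j, c j • f j).natDegree = (f (Fin.last N)).natDegree := by
  have hdegree {j} (hj : c j • f j ≠ 0) : (c j • f j).natDegree = (f j).natDegree :=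
    natDegree_smul _ fun h => hj (by rw [h, zero_smul])
  rw [natDegree_sum_eq_of_disjoint]
  · refine le_antisymm (Finset.sup_le fun j _ => ?_) ?_
    · exact (natDegree_smul_le _ _).trans (hf.monotone (Fin.le_last j))
    · rw [← natDegree_smul (f (Fin.last N)) hc]
      exact Finset.le_sup (f := fun j => (c j • f j).natDegree) (Finset.mem_univ _)
  · rintro i ⟨-, hi⟩ j ⟨-, hj⟩ hij
    simpa only [Function.onFun, Function.comp_apply, hdegree hi, hdegree hj]
      using hf.injective.ne hij

end LinearCombinations

end QuotZeta

theorem theorem3 :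
    -- the series defining `L*` converges absolutely for every complex polynomial
    (∀ f : ℂ[X], Summable
      (fun n : ℕ => ‖(QuotZeta.a (n + 1) : ℂ) * f.eval ((n + 1 : ℕ) : ℂ)‖)) ∧
    -- the quotient formula, for positive even `n`
    (∀ n : ℕ, 0 < n → Even n →
      QuotZeta.dpZero n ≠ 0 ∧
      riemannZeta ((n : ℂ) + 1) / riemannZeta (n : ℂ) =
        (1 - 1 / (n : ℂ)) * (1 - 1 / ((2 : ℂ) ^ (n + 1) - 1)) *
          (QuotZeta.LStarRat (QuotZeta.p n) / (QuotZeta.dpZero n : ℂ))) ∧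
    -- the limit along even `n`
    Tendsto (fun n : ℕ => QuotZeta.LStarRat (QuotZeta.p n) / (QuotZeta.dpZero n : ℂ))
      (atTop ⊓ 𝓟 {n : ℕ | Even n}) (𝓝 1) ∧
    -- rational linear combinations of `N + 1 ≥ 1` quotients
    (∀ (N : ℕ) (α : Fin (N + 1) → ℚ) (n : Fin (N + 1) → ℕ),
      (∀ j, α j ≠ 0) → (∀ j, 0 < n j ∧ Even (n j)) → StrictMono n →
      ∃ q : ℚ[X], q.natDegree = n (Fin.last N) ∧
        ∑ j, (α j : ℂ) * (riemannZeta ((n j : ℂ) + 1) / riemannZeta (n j : ℂ)) =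
          QuotZeta.LStarRat q) := by
  open QuotZeta in
  refine ⟨fun f => (hasSum_a_succ_mul_eval f).summable.norm, fun n hn heven =>
    ⟨dpZero_ne_zero hn heven, ?_⟩, tendsto_LStarRat_p_div_dpZero, fun N α n hα hn hmono => ?_⟩
  · simpa [quotientFactor] using riemannZeta_add_one_div_riemannZeta hn heven
  · have hcoeff (j) : α j * (quotientFactor (n j) / dpZero (n j)) ≠ 0 :=
      mul_ne_zero (hα j) (div_ne_zero
        (quotientFactor_ne_zero (one_lt_of_pos_of_even (hn j).1 (hn j).2))
        (dpZero_ne_zero (hn j).1 (hn j).2))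
    have hdegree (m : ℕ) : (p m).natDegree = m := (monic_p_and_natDegree_p m).2
    refine ⟨∑ j, (α j * (quotientFactor (n j) / dpZero (n j))) • p (n j), ?_, ?_⟩
    · rw [natDegree_sum_smul_of_strictMono (hcoeff _) (by simpa only [hdegree]), hdegree]
    · rw [LStarRat_sum_smul]
      refine Finset.sum_congr rfl fun j _ => ?_
      rw [riemannZeta_add_one_div_riemannZeta (hn j).1 (hn j).2]
      push_cast
      ring
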